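/- Let $\lambda\colon\mathbb{R}^2\to(0,\infty)$ and $\mu\colon\mathbb{R}^2\to[0,\infty)$ be continuous functions that are Lipschitz continuous in the second argument (uniformly in the first one), with $\lambda_{\min}\le\lambda\le\lambda_{\max}$ and $\mu\le\mu_{\max}$ for some constants $0<\lambda_{\min}\le\lambda_{\max}<\infty$ and $\mu_{\max}<\infty$. Assume the vertically homogeneous case, in which $\lambda(x_1,x_2)=\lambda(x_1)$ and $\mu(x_1,x_2)=\mu(x_1)$ do not depend on $x_2$. For $\ell>0$ let $\mathcal P_{\ell,x_1}$, $x_1\in\mathbb{Z}$, be independent Poisson point processes on $\mathbb{R}$ with intensity measures $\lambda(x_1/\ell^2,x_2/\ell^2)\,\mathrm dx_2$, and let $\mathcal P_\ell=\bigcup_{x_1\in\mathbb{Z}}\{x_1\}\times\mathcal P_{\ell,x_1}$ be the set of nodes in $\mathbb{S}=\mathbb{Z}\times\mathbb{R}$. Draw a directed edge from a node $(x_1,x_2)$ to a node $(x_1-1,y)$ if $|x_2-y|<|x_2-z|$ for all other nodes $(x_1-1,z)$. A node $\boldsymbol x$ generates the amount $\mu(\boldsymbol x/\ell^2)$ of traffic,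 which flows to the left along the directed edges. For $\boldsymbol x=(x_1,x_2)\in\mathbb{S}$ let $\tau_\ell(\boldsymbol x)$ be the number of nodes in the longest directed path that ends at a node in the slit $\{x_1\}\times[x_2-\ell/2,x_2+\ell/2]$, with $\tau_\ell(\boldsymbol x)=0$ if the slit contains no node (the size of the weights $\mu$ plays no role for $\tau_\ell$). Then there exists $C<\infty$ such that, for all $\alpha>2$ and all $\ell\ge1$, $$\sup_{\boldsymbol x\in\mathbb{S}}\ \mathbb{P}\big(\tau_\ell(\boldsymbol x)\ge\ell^\alpha\big)<C\,\ell^{1-\alpha/2}.$$ Equivalently, writing $n=\ell^{\alpha}$, one has $\sup_{\boldsymbol x}\mathbb{P}(\tau_{n^{1/\alpha}}(\boldsymbol x)\ge n)<C\,n^{1/\alpha-1/2}$ for all $\alpha>2$ and $n\ge1$. -/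

import Mathlib

open MeasureTheory ProbabilityTheory
open scoped ENNReal NNReal

namespace SemiLattice

/-- `X` is a random set of points on the line, defined on the probability space `(Ω, P)`, which is a
(simple) Poisson point process with intensity measure `ν`: the number of points in a Borel set `B`
is a random variable, it has the Poisson law with parameter `ν B` if this is finite, and the numbers
of points in finitely many pairwise disjoint Borel sets are independent. -/
structure IsPoissonPointProcess {Ω : Type*} [MeasurableSpace Ω] (P : Measure Ω)
    (X : Ω → Set ℝ) (ν : Measure ℝ) : Prop where
  measurable_count : ∀ B : Set ℝ, MeasurableSet B → Measurable fun ω => (X ω ∩ B).encard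
  map_count : ∀ B : Set ℝ, MeasurableSet B → ν B ≠ ∞ →
    P.map (fun ω => (X ω ∩ B).encard)
      = (poissonMeasure (ν B).toNNReal).map (fun k : ℕ => (k : ℕ∞))
  indep_count : ∀ (n : ℕ) (B : Fin n → Set ℝ), (∀ i, MeasurableSet (B i)) →
    Pairwise (fun i j => Disjoint (B i) (B j)) →
    iIndepFun (fun i ω => (X ω ∩ B i).encard) P

/-- The σ-algebra on `Ω` generated by the random point set `X`, that is, by the numbers of its points
in all Borel sets. -/
noncomputable abbrev generatedSigmaAlgebra {Ω : Type*} (X : Ω → Set ℝ) : MeasurableSpace Ω :=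
  ⨆ (B : Set ℝ) (_ : MeasurableSet B),
    MeasurableSpace.comap (fun ω => (X ω ∩ B).encard) inferInstance

/-- The standing assumptions on the intensity function `lam` and the traffic function `mu`. -/
structure IsAdmissible (lam mu : ℝ × ℝ → ℝ) : Prop where
  continuous_lam : Continuous lam
  bounds_lam : ∃ lamMin lamMax : ℝ, 0 < lamMin ∧ ∀ x, lamMin ≤ lam x ∧ lam x ≤ lamMax
  continuous_mu : Continuous mu
  bounds_mu : ∃ muMax : ℝ, ∀ x, 0 ≤ mu x ∧ mu x ≤ muMax
  lipschitz : ∃ Ξ : ℝ≥0, 0 < Ξ ∧ ∀ x₁ : ℝ,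
    LipschitzWith Ξ (fun x₂ => lam (x₁, x₂)) ∧ LipschitzWith Ξ (fun x₂ => mu (x₁, x₂))

/-- A function on the plane that depends on the horizontal coordinate only. -/
def VerticallyHomogeneous (f : ℝ × ℝ → ℝ) : Prop :=
  ∀ x₁ x₂ y₂ : ℝ, f (x₁, x₂) = f (x₁, y₂)

/-- The intensity measure `lam (x₁ / ℓ ^ 2, x₂ / ℓ ^ 2) dx₂` on the vertical line over `x₁`. -/
noncomputable def intensity (lam : ℝ × ℝ → ℝ) (ℓ : ℝ) (x₁ : ℤ) : Measure ℝ :=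
  volume.withDensity fun x₂ => ENNReal.ofReal (lam ((x₁ : ℝ) / ℓ ^ 2, x₂ / ℓ ^ 2))

/-- The columns `X x₁`, for `x₁ ∈ ℤ`, are independent Poisson point processes with intensity measures
`intensity lam ℓ x₁`. -/
structure IsPoissonSemiLattice {Ω : Type*} [MeasurableSpace Ω] (P : Measure Ω)
    (lam : ℝ × ℝ → ℝ) (ℓ : ℝ) (X : ℤ → Ω → Set ℝ) : Prop where
  poisson : ∀ x₁ : ℤ, IsPoissonPointProcess P (X x₁) (intensity lam ℓ x₁)
  indep : iIndep (fun x₁ => generatedSigmaAlgebra (X x₁)) P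

/-- The set of occupied nodes in `ℤ × ℝ`, the union of all the columns. -/
def nodes {Ω : Type*} (X : ℤ → Ω → Set ℝ) (ω : Ω) : Set (ℤ × ℝ) :=
  {x | x.2 ∈ X x.1 ω}

/-- There is a directed edge from the node `x` to the node `y` if `y` lies in the column directly to
the left of `x` and is strictly closer to the height of `x` than all other nodes of that column. -/
def Edge (N : Set (ℤ × ℝ)) (x y : ℤ × ℝ) : Prop :=
  x ∈ N ∧ y ∈ N ∧ y.1 = x.1 - 1 ∧
    ∀ z ∈ N, z.1 = x.1 - 1 → z ≠ y → |x.2 - y.2| < |x.2 - z.2|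

/-- The slit `{x₁} × [x₂ - ℓ / 2, x₂ + ℓ / 2]`. -/
def slit (ℓ : ℝ) (x : ℤ × ℝ) : Set (ℤ × ℝ) :=
  {x.1} ×ˢ Set.Icc (x.2 - ℓ / 2) (x.2 + ℓ / 2)

/-- `p` lists the successive nodes of a directed path along which traffic, generated at the first
node of `p`, flows into the slit at `x`; the last node of `p` is the one in the slit. -/
def IsPathInto (N : Set (ℤ × ℝ)) (ℓ : ℝ) (x : ℤ × ℝ) (p : List (ℤ × ℝ)) : Prop :=
  (∀ v ∈ p, v ∈ N) ∧ p.IsChain (Edge N) ∧ ∃ v ∈ p.getLast?, v ∈ slit ℓ x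

/-- The number of nodes in the longest path that carries traffic flowing through the slit at `x`
(it is `0` if there is no such path, and `⊤` if there are arbitrarily long ones). -/
noncomputable def tau (N : Set (ℤ × ℝ)) (ℓ : ℝ) (x : ℤ × ℝ) : ℕ∞ :=
  ⨆ (p : List (ℤ × ℝ)) (_ : IsPathInto N ℓ x p), (p.length : ℕ∞)

end SemiLattice

/-! Follow backwards the region that drains into the slit. A node whose nearest neighbour in the
column to its left lies in `(d, e]` must itself lie in `(mid d S, mid e S]`, where `S` is that
column (`IsGood.mem_Ioc_mid`). Iterating over the columns gives two `boundaries`, and a path of `n`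
nodes forces a point of each of the first `n` columns to lie between them
(`forall_next_le_of_isPathInto`). It remains to bound how long the boundaries stay apart.

Vertical homogeneity makes each column a Poisson process of constant rate, so by symmetry `mid d`
has mean `d` (`integral_mid`) and the width between the boundaries is a nonnegative martingale. When
no point separates the boundaries they merge for good. From width `w` such a process survives `n`
steps with probability of order `w / √n`; with `w` of order `ℓ` and `n ≥ ℓ ^ α` this is the claimed
rate.

The survival bound uses no stopping times. For `θ = 1 / √n` the concave function `1 - exp (-θ z)` of
the width, plus `θ ^ 2` while the width is positive, loses of order `θ ^ 2` per step: wide intervals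
lose through a quantitative Jensen inequality (`le_integral_exp_neg`), narrow ones by their chance
to merge. `integral_potential_mid_sub_mid` combines both cases and `measure_forall_next_le` sums the
losses. -/

namespace SemiLattice

/-! ### Measurability of point sets -/

/-- Sets of points on the line, with the σ-algebra generated by the numbers of points in Borel
sets. -/
def PointSet : Type := Set ℝ

noncomputable instance PointSet.instMeasurableSpace : MeasurableSpace PointSet :=
  ⨆ (B : Set ℝ) (_ : MeasurableSet B),
    MeasurableSpace.comap (fun S : Set ℝ => (S ∩ B).encard) inferInstance

lemma measurable_encard_inter {B : Set ℝ} (hB : MeasurableSet B) :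
    Measurable fun S : PointSet => Set.encard ((S : Set ℝ) ∩ B) := by
  have h : MeasurableSpace.comap (fun S : Set ℝ => (S ∩ B).encard) inferInstance ≤
      (inferInstance : MeasurableSpace PointSet) :=
    le_iSup₂ (f := fun (B : Set ℝ) (_ : MeasurableSet B) =>
      MeasurableSpace.comap (fun S : Set ℝ => (S ∩ B).encard) inferInstance) B hB
  exact Measurable.mono (comap_measurable _) h le_rfl

lemma measurableSet_encard_inter {B : Set ℝ} (hB : MeasurableSet B) (T : Set ℕ∞) :
    MeasurableSet {S : PointSet | Set.encard ((S : Set ℝ) ∩ B) ∈ T} :=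
  measurable_encard_inter hB (MeasurableSet.of_discrete (s := T))

/-- Turns independence of the generated σ-algebras into independence of `PointSet`-valued random
variables. -/
lemma comap_pointSet {Ω : Type*} (X : Ω → Set ℝ) :
    MeasurableSpace.comap X PointSet.instMeasurableSpace = generatedSigmaAlgebra X := by
  change MeasurableSpace.comap X (⨆ (B : Set ℝ) (_ : MeasurableSet B),
    MeasurableSpace.comap (fun S : Set ℝ => (S ∩ B).encard) inferInstance) = _
  simp only [MeasurableSpace.comap_iSup]
  exact iSup_congr fun B => iSup_congr fun _ => MeasurableSpace.comap_comp

/-- A set of points that is locally finite and unbounded in both directions. -/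
def IsGood (S : Set ℝ) : Prop :=
  ∀ n : ℕ, (S ∩ Set.Icc (-n : ℝ) n).encard ≠ ⊤ ∧ (S ∩ Set.Ioi (n : ℝ)).encard ≠ 0 ∧
    (S ∩ Set.Iio (-n : ℝ)).encard ≠ 0

lemma measurableSet_isGood : MeasurableSet {S : PointSet | IsGood S} := by
  have h : {S : PointSet | IsGood S} = ⋂ n : ℕ,
      ({S : PointSet | Set.encard ((S : Set ℝ) ∩ Set.Icc (-n : ℝ) n) ∈ ({⊤}ᶜ : Set ℕ∞)} ∩
      {S : PointSet | Set.encard ((S : Set ℝ) ∩ Set.Ioi (n : ℝ)) ∈ ({0}ᶜ : Set ℕ∞)}) ∩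
      {S : PointSet | Set.encard ((S : Set ℝ) ∩ Set.Iio (-n : ℝ)) ∈ ({0}ᶜ : Set ℕ∞)} := by
    ext S
    simp only [IsGood, Set.mem_ofPred_eq, Set.mem_iInter, Set.mem_inter_iff, Set.mem_compl_iff,
      Set.mem_singleton_iff, and_assoc, ne_eq]
  rw [h]
  exact MeasurableSet.iInter fun n => ((measurableSet_encard_inter measurableSet_Icc _).inter
    (measurableSet_encard_inter measurableSet_Ioi _)).inter
    (measurableSet_encard_inter measurableSet_Iio _)

lemma IsGood.finite_inter_Icc {S : Set ℝ} (hS : IsGood S) (a b : ℝ) :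
    (S ∩ Set.Icc a b).Finite := by
  obtain ⟨n, hn⟩ := exists_nat_ge (max (-a) b)
  refine (Set.encard_ne_top_iff.1 (hS n).1).subset ?_
  rintro x ⟨hx, h1, h2⟩
  exact ⟨hx, by linarith [le_max_left (-a) b], by linarith [le_max_right (-a) b]⟩

lemma IsGood.exists_gt {S : Set ℝ} (hS : IsGood S) (d : ℝ) : ∃ s ∈ S, d < s := by
  obtain ⟨n, hn⟩ := exists_nat_ge d
  obtain ⟨s, hs, h⟩ := Set.encard_ne_zero.1 (hS n).2.1
  exact ⟨s, hs, hn.trans_lt h⟩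

lemma IsGood.exists_lt {S : Set ℝ} (hS : IsGood S) (d : ℝ) : ∃ s ∈ S, s < d := by
  obtain ⟨n, hn⟩ := exists_nat_ge (-d)
  obtain ⟨s, hs, h⟩ := Set.encard_ne_zero.1 (hS n).2.2
  exact ⟨s, hs, by linarith [Set.mem_Iio.1 h]⟩

/-! ### Neighbouring points and midpoints -/

open Classical in
/-- The lowest point strictly above `d`. -/
noncomputable def next (d : ℝ) (S : Set ℝ) : ℝ :=
  -- The default `d`, here and in `prev`, makes `mid · S` the identity when `S` is not good, so that
  -- monotonicity in `d` holds for every `S`.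
  if IsGood S then sInf (S ∩ Set.Ioi d) else d

open Classical in
/-- The highest point that is not above `d`. -/
noncomputable def prev (d : ℝ) (S : Set ℝ) : ℝ :=
  if IsGood S then sSup (S ∩ Set.Iic d) else d

/-- The midpoint of the two consecutive points that surround `d`. -/
noncomputable def mid (d : ℝ) (S : Set ℝ) : ℝ := (prev d S + next d S) / 2

lemma IsGood.isLeast_next {S : Set ℝ} (hS : IsGood S) (d : ℝ) :
    IsLeast (S ∩ Set.Ioi d) (next d S) := by
  obtain ⟨s, hs, hds⟩ := hS.exists_gt d
  have hfin : (S ∩ Set.Ioc d s).Finite := (hS.finite_inter_Icc d s).subset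
    (Set.inter_subset_inter_right _ Set.Ioc_subset_Icc_self)
  obtain ⟨m, ⟨hmS, hm1, hm2⟩, hm⟩ := Set.exists_min_image _ id hfin ⟨s, hs, hds, le_rfl⟩
  have : IsLeast (S ∩ Set.Ioi d) m := by
    refine ⟨⟨hmS, hm1⟩, fun x hx => ?_⟩
    rcases le_total x s with h | h
    · exact hm x ⟨hx.1, hx.2, h⟩
    · exact hm2.trans h
  rw [next, if_pos hS, this.csInf_eq]
  exact this

lemma IsGood.isGreatest_prev {S : Set ℝ} (hS : IsGood S) (d : ℝ) :
    IsGreatest (S ∩ Set.Iic d) (prev d S) := by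
  obtain ⟨s, hs, hds⟩ := hS.exists_lt d
  have hfin : (S ∩ Set.Icc s d).Finite := hS.finite_inter_Icc s d
  obtain ⟨m, ⟨hmS, hm1, hm2⟩, hm⟩ := Set.exists_max_image _ id hfin ⟨s, hs, le_rfl, hds.le⟩
  have : IsGreatest (S ∩ Set.Iic d) m := by
    refine ⟨⟨hmS, hm2⟩, fun x hx => ?_⟩
    rcases le_total s x with h | h
    · exact hm x ⟨hx.1, h, hx.2⟩
    · exact h.trans hm1
  rw [prev, if_pos hS, this.csSup_eq]
  exact this

lemma IsGood.lt_next {S : Set ℝ} (hS : IsGood S) (d : ℝ) : d < next d S := (hS.isLeast_next d).1.2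

lemma IsGood.prev_le {S : Set ℝ} (hS : IsGood S) (d : ℝ) : prev d S ≤ d := (hS.isGreatest_prev d).1.2

lemma le_next (d : ℝ) (S : Set ℝ) : d ≤ next d S := by
  by_cases hS : IsGood S
  · exact (hS.lt_next d).le
  · rw [next, if_neg hS]

lemma prev_le (d : ℝ) (S : Set ℝ) : prev d S ≤ d := by
  by_cases hS : IsGood S
  · exact hS.prev_le d
  · rw [prev, if_neg hS]

/-- The rational `q` replaces the variable endpoint `d`, so that the event becomes a countable
union, measurable jointly in `d` and `S`. -/
lemma IsGood.next_lt_iff {S : Set ℝ} (hS : IsGood S) (d t : ℝ) :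
    next d S < t ↔ ∃ q : ℚ, d < q ∧ (S ∩ Set.Ioo (q : ℝ) t).encard ≠ 0 := by
  simp only [Set.encard_ne_zero]
  constructor
  · intro h
    obtain ⟨q, hq1, hq2⟩ := exists_rat_btwn (hS.lt_next d)
    exact ⟨q, hq1, next d S, (hS.isLeast_next d).1.1, hq2, h⟩
  · rintro ⟨q, hq, x, hx, hx1, hx2⟩
    exact ((hS.isLeast_next d).2 ⟨hx, hq.trans hx1⟩).trans_lt hx2

lemma IsGood.prev_lt_iff {S : Set ℝ} (hS : IsGood S) (d t : ℝ) :
    prev d S < t ↔ ∃ q : ℚ, d < q ∧ (S ∩ Set.Icc t (q : ℝ)).encard = 0 := by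
  simp only [Set.encard_eq_zero]
  constructor
  · intro h
    obtain ⟨q, hq1, hq2⟩ := exists_rat_btwn (hS.lt_next d)
    refine ⟨q, hq1, Set.eq_empty_of_forall_notMem ?_⟩
    rintro x ⟨hx, hx1, hx2⟩
    rcases le_or_gt x d with hxd | hxd
    · exact absurd ((hS.isGreatest_prev d).2 ⟨hx, hxd⟩) (by linarith)
    · exact absurd ((hS.isLeast_next d).2 ⟨hx, hxd⟩) (by linarith)
  · rintro ⟨q, hq, h⟩
    by_contra! hlt
    have : prev d S ∈ S ∩ Set.Icc t (q : ℝ) :=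
      ⟨(hS.isGreatest_prev d).1.1, hlt, (hS.prev_le d).trans hq.le⟩
    rw [h] at this
    exact this

lemma measurableSet_snd_isGood : MeasurableSet {p : ℝ × PointSet | IsGood p.2} :=
  measurable_snd measurableSet_isGood

lemma measurable_next : Measurable fun p : ℝ × PointSet => next p.1 p.2 := by
  refine measurable_of_Iio fun t => ?_
  have h : (fun p : ℝ × PointSet => next p.1 p.2) ⁻¹' Set.Iio t =
      ({p : ℝ × PointSet | IsGood p.2} ∩ ⋃ q : ℚ, {p : ℝ × PointSet | p.1 < q} ∩
        Prod.snd ⁻¹' {S : PointSet | Set.encard ((S : Set ℝ) ∩ Set.Ioo (q : ℝ) t) ∈ ({0}ᶜ : Set ℕ∞)})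
      ∪ ({p : ℝ × PointSet | IsGood p.2}ᶜ ∩ {p : ℝ × PointSet | p.1 < t}) := by
    ext ⟨d, S⟩
    by_cases hS : IsGood S
    · simpa [hS] using hS.next_lt_iff d t
    · simp [hS, next]
  rw [h]
  refine (measurableSet_snd_isGood.inter (MeasurableSet.iUnion fun q => ?_)).union
    (measurableSet_snd_isGood.compl.inter (measurable_fst measurableSet_Iio))
  exact (measurable_fst measurableSet_Iio).inter
    (measurable_snd (measurableSet_encard_inter measurableSet_Ioo _))

lemma measurable_prev : Measurable fun p : ℝ × PointSet => prev p.1 p.2 := by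
  refine measurable_of_Iio fun t => ?_
  have h : (fun p : ℝ × PointSet => prev p.1 p.2) ⁻¹' Set.Iio t =
      ({p : ℝ × PointSet | IsGood p.2} ∩ ⋃ q : ℚ, {p : ℝ × PointSet | p.1 < q} ∩
        Prod.snd ⁻¹' {S : PointSet | Set.encard ((S : Set ℝ) ∩ Set.Icc t (q : ℝ)) ∈ ({0} : Set ℕ∞)})
      ∪ ({p : ℝ × PointSet | IsGood p.2}ᶜ ∩ {p : ℝ × PointSet | p.1 < t}) := by
    ext ⟨d, S⟩
    by_cases hS : IsGood S
    · simpa [hS] using hS.prev_lt_iff d t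
    · simp [hS, prev]
  rw [h]
  refine (measurableSet_snd_isGood.inter (MeasurableSet.iUnion fun q => ?_)).union
    (measurableSet_snd_isGood.compl.inter (measurable_fst measurableSet_Iio))
  exact (measurable_fst measurableSet_Iio).inter
    (measurable_snd (measurableSet_encard_inter measurableSet_Icc _))

lemma mid_mono (S : Set ℝ) : Monotone fun d => mid d S := by
  intro d e hde
  by_cases hS : IsGood S
  · have h1 : prev d S ≤ prev e S := (hS.isGreatest_prev e).2
      ⟨(hS.isGreatest_prev d).1.1, (hS.prev_le d).trans hde⟩
    have h2 : next d S ≤ next e S := (hS.isLeast_next d).2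
      ⟨(hS.isLeast_next e).1.1, hde.trans_lt (hS.lt_next e)⟩
    simp only [mid]
    linarith
  · simpa [mid, next, prev, hS] using hde

lemma IsGood.next_le_iff {S : Set ℝ} (hS : IsGood S) (d e : ℝ) :
    next d S ≤ e ↔ (S ∩ Set.Ioc d e).Nonempty := by
  constructor
  · exact fun h => ⟨next d S, (hS.isLeast_next d).1.1, hS.lt_next d, h⟩
  · rintro ⟨x, hx, h1, h2⟩
    exact ((hS.isLeast_next d).2 ⟨hx, h1⟩).trans h2

/-- If no point separates `d` from `e`, they have the same midpoint. -/
lemma IsGood.mid_eq_of_lt_next {S : Set ℝ} (hS : IsGood S) {d e : ℝ} (hde : d ≤ e)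
    (h : e < next d S) : mid e S = mid d S := by
  have h1 : prev e S ≤ d := by
    by_contra! hlt
    exact absurd ((hS.isLeast_next d).2 ⟨(hS.isGreatest_prev e).1.1, hlt⟩)
      (by linarith [hS.prev_le e])
  have h2 : prev e S = prev d S := le_antisymm
    ((hS.isGreatest_prev d).2 ⟨(hS.isGreatest_prev e).1.1, h1⟩)
    ((hS.isGreatest_prev e).2 ⟨(hS.isGreatest_prev d).1.1, (hS.prev_le d).trans hde⟩)
  have h3 : next e S = next d S := le_antisymm
    ((hS.isLeast_next e).2 ⟨(hS.isLeast_next d).1.1, h⟩)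
    ((hS.isLeast_next d).2 ⟨(hS.isLeast_next e).1.1, hde.trans_lt (hS.lt_next e)⟩)
  rw [mid, mid, h2, h3]

/-- A height whose nearest point lies in `(d, e]` lies between the midpoints of `d` and `e`. -/
lemma IsGood.mem_Ioc_mid {S : Set ℝ} (hS : IsGood S) {d e p v : ℝ} (hp : p ∈ S)
    (hpde : p ∈ Set.Ioc d e) (hv : ∀ z ∈ S, z ≠ p → |v - p| < |v - z|) :
    v ∈ Set.Ioc (mid d S) (mid e S) := by
  obtain ⟨hdp, hpe⟩ := hpde
  constructor
  · have hlt : prev d S < p := (hS.prev_le d).trans_lt hdp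
    -- Being closer to `p` than to `prev d S` puts `v` above their midpoint, which is at least `mid
    -- d S` because `next d S ≤ p`.
    have h1 := sq_lt_sq.2 (hv _ (hS.isGreatest_prev d).1.1 hlt.ne)
    have h2 : next d S ≤ p := (hS.isLeast_next d).2 ⟨hp, hdp⟩
    simp only [mid]
    nlinarith
  · have hlt : p < next e S := hpe.trans_lt (hS.lt_next e)
    have h1 := sq_lt_sq.2 (hv _ (hS.isLeast_next e).1.1 hlt.ne')
    have h2 : p ≤ prev e S := (hS.isGreatest_prev e).2 ⟨hp, hpe⟩
    simp only [mid]
    nlinarith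

/-- If the two end zones of the interval `[d, e]` contain no point and there are points just outside
of it, then the midpoints are closer to each other by one. -/
lemma IsGood.mid_sub_mid_le {S : Set ℝ} (hS : IsGood S) {d e : ℝ}
    (hgap : S ∩ (Set.Icc d (d + 2) ∪ Set.Icc (e - 2) e) = ∅)
    (hd : (S ∩ Set.Ioo (d - 1) d).Nonempty) (he : (S ∩ Set.Ioo e (e + 1)).Nonempty) :
    mid e S - mid d S ≤ e - d - 1 := by
  have hgap' : ∀ x ∈ S, x ∉ Set.Icc d (d + 2) ∪ Set.Icc (e - 2) e := fun x hx hx' => by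
    have : x ∈ S ∩ (Set.Icc d (d + 2) ∪ Set.Icc (e - 2) e) := ⟨hx, hx'⟩
    rw [hgap] at this
    exact this
  obtain ⟨x, hx, hx1, hx2⟩ := hd
  obtain ⟨y, hy, hy1, hy2⟩ := he
  have h1 : x ≤ prev d S := (hS.isGreatest_prev d).2 ⟨hx, hx2.le⟩
  have h2 : next e S ≤ y := (hS.isLeast_next e).2 ⟨hy, hy1⟩
  have h3 : d + 2 ≤ next d S := by
    by_contra! hlt
    exact hgap' _ (hS.isLeast_next d).1.1 (Or.inl ⟨(hS.lt_next d).le, hlt.le⟩)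
  have h4 : prev e S ≤ e - 2 := by
    by_contra! hlt
    exact hgap' _ (hS.isGreatest_prev e).1.1 (Or.inr ⟨hlt.le, hS.prev_le e⟩)
  -- Each midpoint moves inwards by at least `1 / 2`: `prev d S > d - 1` and `next d S ≥ d + 2`, and
  -- symmetrically at `e`.
  simp only [mid]
  linarith

/-! ### Estimates for one Poisson column of constant rate -/

namespace IsPoissonPointProcess

variable {Ω : Type*} [MeasurableSpace Ω] {P : Measure Ω} {X : Ω → Set ℝ}

lemma measurable {ν : Measure ℝ} (hX : IsPoissonPointProcess P X ν) :
    @Measurable Ω PointSet _ _ X := by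
  refine measurable_iff_comap_le.2 ((comap_pointSet X).le.trans ?_)
  exact iSup₂_le fun B hB => (hX.measurable_count B hB).comap_le

variable {r : ℝ}

lemma measure_inter_eq_empty [IsProbabilityMeasure P] (hr : 0 < r)
    (hX : IsPoissonPointProcess P X (ENNReal.ofReal r • volume))
    {B : Set ℝ} (hB : MeasurableSet B) (hB' : volume B ≠ ∞) :
    P {ω | X ω ∩ B = ∅} = ENNReal.ofReal (Real.exp (-(r * volume.real B))) := by
  have h1 := hX.map_count B hB (by
    simpa using ENNReal.mul_ne_top ENNReal.ofReal_ne_top hB')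
  have h2 : P {ω | X ω ∩ B = ∅} =
      P.map (fun ω => Set.encard (X ω ∩ B)) {0} := by
    rw [Measure.map_apply (hX.measurable_count B hB) (measurableSet_singleton _)]
    congr 1
    ext ω
    simp
  rw [h2, h1, Measure.map_apply (Measurable.of_discrete) (measurableSet_singleton _)]
  have h3 : (fun k : ℕ => (k : ℕ∞)) ⁻¹' {0} = {0} := by ext; simp
  rw [h3, poissonMeasure_singleton]
  simp [Measure.real, hr.le, ENNReal.coe_toNNReal_eq_toReal]

lemma measure_encard_eq_top [IsProbabilityMeasure P]
    (hX : IsPoissonPointProcess P X (ENNReal.ofReal r • volume))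
    {B : Set ℝ} (hB : MeasurableSet B) (hB' : volume B ≠ ∞) :
    P {ω | Set.encard (X ω ∩ B) = ⊤} = 0 := by
  have h1 := hX.map_count B hB (by
    simpa using ENNReal.mul_ne_top ENNReal.ofReal_ne_top hB')
  have h2 : P {ω | Set.encard (X ω ∩ B) = ⊤} =
      P.map (fun ω => Set.encard (X ω ∩ B)) {⊤} := by
    rw [Measure.map_apply (hX.measurable_count B hB) (measurableSet_singleton _)]
    rfl
  rw [h2, h1, Measure.map_apply (Measurable.of_discrete) (measurableSet_singleton _)]
  have h3 : (fun k : ℕ => (k : ℕ∞)) ⁻¹' {⊤} = ∅ := by ext; simp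
  rw [h3, measure_empty]

lemma measure_inter_eq_empty_of_forall [IsProbabilityMeasure P] (hr : 0 < r)
    (hX : IsPoissonPointProcess P X (ENNReal.ofReal r • volume))
    {B : Set ℝ} (hB : ∀ n : ℕ, ∃ a : ℝ, Set.Ioo a (a + n) ⊆ B) :
    P {ω | X ω ∩ B = ∅} = 0 := by
  have hle : ∀ n : ℕ, P {ω | X ω ∩ B = ∅} ≤
      ENNReal.ofReal (Real.exp (-(r * n))) := by
    intro n
    obtain ⟨a, ha⟩ := hB n
    have := hX.measure_inter_eq_empty hr (measurableSet_Ioo (a := a) (b := a + n)) (by simp)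
    simp only [Measure.real, Real.volume_Ioo, add_sub_cancel_left] at this
    rw [ENNReal.toReal_ofReal (Nat.cast_nonneg n)] at this
    rw [← this]
    exact measure_mono fun ω (hω : _ = _) => Set.subset_empty_iff.1
      ((Set.inter_subset_inter_right _ ha).trans hω.subset)
  have hlim : Filter.Tendsto (fun n : ℕ => ENNReal.ofReal (Real.exp (-(r * n)))) Filter.atTop
      (nhds 0) := by
    rw [← ENNReal.ofReal_zero]
    refine (ENNReal.continuous_ofReal.tendsto 0).comp (Real.tendsto_exp_neg_atTop_nhds_zero.comp ?_)
    exact tendsto_natCast_atTop_atTop.const_mul_atTop hr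
  exact le_antisymm (ge_of_tendsto' hlim hle) zero_le

lemma ae_isGood [IsProbabilityMeasure P] (hr : 0 < r)
    (hX : IsPoissonPointProcess P X (ENNReal.ofReal r • volume)) :
    ∀ᵐ ω ∂P, IsGood (X ω) := by
  simp only [IsGood]
  rw [ae_all_iff]
  intro n
  have h1 : ∀ᵐ ω ∂P, Set.encard (X ω ∩ Set.Icc (-n : ℝ) n) ≠ ⊤ := by
    rw [ae_iff]
    simpa using hX.measure_encard_eq_top (measurableSet_Icc (a := (-n : ℝ)) (b := n)) (by simp)
  have h2 : ∀ᵐ ω ∂P, Set.encard (X ω ∩ Set.Ioi (n : ℝ)) ≠ 0 := by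
    rw [ae_iff]
    simpa using hX.measure_inter_eq_empty_of_forall hr (B := Set.Ioi (n : ℝ))
      fun m => ⟨n, fun x hx => hx.1⟩
  have h3 : ∀ᵐ ω ∂P, Set.encard (X ω ∩ Set.Iio (-n : ℝ)) ≠ 0 := by
    rw [ae_iff]
    simpa using hX.measure_inter_eq_empty_of_forall hr (B := Set.Iio (-n : ℝ))
      fun m => ⟨-n - m, fun x hx => by simpa using hx.2⟩
  filter_upwards [h1, h2, h3] with ω a b c using ⟨a, b, c⟩

lemma measurable_next_const {ν : Measure ℝ}
    (hX : IsPoissonPointProcess P X ν) (d : ℝ) :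
    Measurable fun ω => next d (X ω) :=
  measurable_next.comp (measurable_const.prodMk hX.measurable)

lemma measurable_prev_const {ν : Measure ℝ}
    (hX : IsPoissonPointProcess P X ν) (d : ℝ) :
    Measurable fun ω => prev d (X ω) :=
  measurable_prev.comp (measurable_const.prodMk hX.measurable)

lemma measurable_mid_sub_mid {ν : Measure ℝ} (hX : IsPoissonPointProcess P X ν) (d e : ℝ) :
    Measurable fun ω => mid e (X ω) - mid d (X ω) :=
  (((hX.measurable_prev_const e).add (hX.measurable_next_const e)).div_const 2).sub
    (((hX.measurable_prev_const d).add (hX.measurable_next_const d)).div_const 2)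

variable [IsProbabilityMeasure P]

/-- The gap exceeds `t` exactly when `(d, d + t]` is empty, so its tail is exponential. The gap
below `d` has the same tail, which makes `mid` unbiased. -/
lemma lintegral_next_sub (hr : 0 < r)
    (hX : IsPoissonPointProcess P X (ENNReal.ofReal r • volume)) (d : ℝ) :
    ∫⁻ ω, ENNReal.ofReal (next d (X ω) - d) ∂P =
      ∫⁻ t in Set.Ioi (0 : ℝ), ENNReal.ofReal (Real.exp (-r * t)) := by
  rw [lintegral_eq_lintegral_meas_lt P (ae_of_all _ fun ω => sub_nonneg.2 (le_next d _))
    ((hX.measurable_next_const d).sub_const d).aemeasurable]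
  refine setLIntegral_congr_fun measurableSet_Ioi fun t (ht : 0 < t) => ?_
  have h := hX.measure_inter_eq_empty hr (measurableSet_Ioc (a := d) (b := d + t)) (by simp)
  simp only [Measure.real, Real.volume_Ioc, add_sub_cancel_left, ENNReal.toReal_ofReal ht.le] at h
  rw [neg_mul, ← h]
  refine measure_congr ?_
  filter_upwards [hX.ae_isGood hr] with ω hω
  refine propext ?_
  change t < next d (X ω) - d ↔ X ω ∩ Set.Ioc d (d + t) = ∅
  rw [← Set.not_nonempty_iff_eq_empty, ← hω.next_le_iff, not_le, lt_sub_iff_add_lt']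

lemma lintegral_sub_prev (hr : 0 < r)
    (hX : IsPoissonPointProcess P X (ENNReal.ofReal r • volume)) (d : ℝ) :
    ∫⁻ ω, ENNReal.ofReal (d - prev d (X ω)) ∂P =
      ∫⁻ t in Set.Ioi (0 : ℝ), ENNReal.ofReal (Real.exp (-r * t)) := by
  rw [lintegral_eq_lintegral_meas_lt P (ae_of_all _ fun ω => sub_nonneg.2 (prev_le d _))
    ((hX.measurable_prev_const d).const_sub d).aemeasurable]
  refine setLIntegral_congr_fun measurableSet_Ioi fun t (ht : 0 < t) => ?_
  have h := hX.measure_inter_eq_empty hr (measurableSet_Icc (a := d - t) (b := d)) (by simp)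
  simp only [Measure.real, Real.volume_Icc, sub_sub_cancel, ENNReal.toReal_ofReal ht.le] at h
  rw [neg_mul, ← h]
  refine measure_congr ?_
  filter_upwards [hX.ae_isGood hr] with ω hω
  refine propext ?_
  change t < d - prev d (X ω) ↔ X ω ∩ Set.Icc (d - t) d = ∅
  rw [lt_sub_comm]
  constructor
  · rintro h
    refine Set.eq_empty_of_forall_notMem ?_
    rintro x ⟨hx, h1, h2⟩
    linarith [(hω.isGreatest_prev d).2 ⟨hx, h2⟩]
  · intro h
    by_contra! hlt
    have : prev d (X ω) ∈ X ω ∩ Set.Icc (d - t) d :=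
      ⟨(hω.isGreatest_prev d).1.1, hlt, hω.prev_le d⟩
    rw [h] at this
    exact this

lemma lintegral_exp_lt_top (hr : 0 < r) :
    ∫⁻ t in Set.Ioi (0 : ℝ), ENNReal.ofReal (Real.exp (-r * t)) < ∞ :=
  (exp_neg_integrableOn_Ioi 0 hr).lintegral_lt_top

lemma integrable_next_sub (hr : 0 < r)
    (hX : IsPoissonPointProcess P X (ENNReal.ofReal r • volume)) (d : ℝ) :
    Integrable (fun ω => next d (X ω) - d) P := by
  refine ⟨((hX.measurable_next_const d).sub_const d).aestronglyMeasurable, ?_⟩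
  rw [hasFiniteIntegral_iff_ofReal (ae_of_all _ fun ω => sub_nonneg.2 (le_next d _)),
    hX.lintegral_next_sub hr]
  exact lintegral_exp_lt_top hr

lemma integrable_sub_prev (hr : 0 < r)
    (hX : IsPoissonPointProcess P X (ENNReal.ofReal r • volume)) (d : ℝ) :
    Integrable (fun ω => d - prev d (X ω)) P := by
  refine ⟨((hX.measurable_prev_const d).const_sub d).aestronglyMeasurable, ?_⟩
  rw [hasFiniteIntegral_iff_ofReal (ae_of_all _ fun ω => sub_nonneg.2 (prev_le d _)),
    hX.lintegral_sub_prev hr]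
  exact lintegral_exp_lt_top hr

lemma mid_eq (d : ℝ) (S : Set ℝ) : mid d S = d + ((next d S - d) - (d - prev d S)) / 2 := by
  rw [mid]; ring

lemma integrable_mid (hr : 0 < r)
    (hX : IsPoissonPointProcess P X (ENNReal.ofReal r • volume)) (d : ℝ) :
    Integrable (fun ω => mid d (X ω)) P := by
  simp only [mid_eq]
  exact (integrable_const d).add
    (((hX.integrable_next_sub hr d).sub (hX.integrable_sub_prev hr d)).div_const 2)

/-- The midpoint of the two consecutive points around `d` has mean `d`. -/
lemma integral_mid (hr : 0 < r)
    (hX : IsPoissonPointProcess P X (ENNReal.ofReal r • volume)) (d : ℝ) :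
    ∫ ω, mid d (X ω) ∂P = d := by
  have h1 := hX.integrable_next_sub hr d
  have h2 := hX.integrable_sub_prev hr d
  have h : ∫ ω, (next d (X ω) - d) ∂P = ∫ ω, (d - prev d (X ω)) ∂P := by
    rw [integral_eq_lintegral_of_nonneg_ae (ae_of_all _ fun ω => sub_nonneg.2 (le_next d _)) h1.1,
      integral_eq_lintegral_of_nonneg_ae (ae_of_all _ fun ω => sub_nonneg.2 (prev_le d _)) h2.1,
      hX.lintegral_next_sub hr, hX.lintegral_sub_prev hr]
  simp only [mid_eq]
  have h3 : Integrable (fun ω => ((next d (X ω) - d) - (d - prev d (X ω))) / 2) P :=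
    (h1.sub h2).div_const 2
  rw [integral_add (integrable_const d) h3, integral_div, integral_sub h1 h2, h]
  simp

/-- The probability that both boundaries of a long interval move inwards by a fixed amount. -/
lemma le_measure_mid_sub_mid {a b : ℝ} (ha : 0 < a) (har : a ≤ r) (hrb : r ≤ b)
    (hX : IsPoissonPointProcess P X (ENNReal.ofReal r • volume))
    {d e : ℝ} (hde : d + 4 < e) :
    Real.exp (-(4 * b)) * (1 - Real.exp (-a)) ^ 2 ≤
      P.real {ω | mid e (X ω) - mid d (X ω) ≤ e - d - 1} := by
  have hr : 0 < r := ha.trans_le har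
  -- Disjoint sets of lengths at most `4`, `1` and `1`: the first is to be empty and the others
  -- occupied, whence the factors `exp (-4b)` and `(1 - exp (-a)) ^ 2`.
  set B : Fin 3 → Set ℝ := ![Set.Icc d (d + 2) ∪ Set.Icc (e - 2) e, Set.Ioo (d - 1) d,
    Set.Ioo e (e + 1)] with hB
  have hBm : ∀ i, MeasurableSet (B i) := by
    intro i
    fin_cases i
    · exact measurableSet_Icc.union measurableSet_Icc
    · exact measurableSet_Ioo
    · exact measurableSet_Ioo
  have hBd : Pairwise fun i j => Disjoint (B i) (B j) := by
    have h01 : Disjoint (B 0) (B 1) := by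
      rw [Set.disjoint_left]
      rintro x (⟨h1, h2⟩ | ⟨h1, h2⟩) ⟨h3, h4⟩ <;> linarith
    have h02 : Disjoint (B 0) (B 2) := by
      rw [Set.disjoint_left]
      rintro x (⟨h1, h2⟩ | ⟨h1, h2⟩) ⟨h3, h4⟩ <;> linarith
    have h12 : Disjoint (B 1) (B 2) := by
      rw [Set.disjoint_left]
      rintro x ⟨h1, h2⟩ ⟨h3, h4⟩
      linarith
    intro i j hij
    fin_cases i <;> fin_cases j <;>
      first | exact absurd rfl hij | exact h01 | exact h01.symm | exact h02 | exact h02.symm |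
        exact h12 | exact h12.symm
  have hind := (hX.indep_count 3 B hBm hBd).measure_inter_preimage_eq_mul Finset.univ
    (sets := ![{0}, {0}ᶜ, {0}ᶜ]) (fun i _ => MeasurableSet.of_discrete)
  rw [Fin.prod_univ_three] at hind
  have hpt : ∀ {C : Set ℝ}, MeasurableSet C → volume C = 1 →
      1 - Real.exp (-a) ≤ P.real ((fun ω => Set.encard (X ω ∩ C)) ⁻¹' {0}ᶜ) := by
    intro C hC hC1
    rw [Set.preimage_compl, probReal_compl_eq_one_sub (hX.measurable_count C hC
      (measurableSet_singleton _))]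
    have h := hX.measure_inter_eq_empty hr hC (by simp [hC1])
    have h' : (fun ω => Set.encard (X ω ∩ C)) ⁻¹' {0} = {ω | X ω ∩ C = ∅} := by
      ext; simp
    rw [h', Measure.real, h, ENNReal.toReal_ofReal (Real.exp_pos _).le]
    simp only [Measure.real, hC1, ENNReal.toReal_one, mul_one]
    gcongr
  have h0 : Real.exp (-(4 * b)) ≤
      P.real ((fun ω => Set.encard (X ω ∩ B 0)) ⁻¹' {0}) := by
    have hvol : volume (B 0) ≤ ENNReal.ofReal 4 := by
      refine (measure_union_le _ _).trans ?_
      rw [Real.volume_Icc, Real.volume_Icc, ← ENNReal.ofReal_add (by linarith) (by linarith)]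
      exact ENNReal.ofReal_le_ofReal (by linarith)
    have h := hX.measure_inter_eq_empty hr (hBm 0) (hvol.trans_lt ENNReal.ofReal_lt_top).ne
    have h' : (fun ω => Set.encard (X ω ∩ B 0)) ⁻¹' {0} =
        {ω | X ω ∩ B 0 = ∅} := by
      ext; simp
    rw [h', Measure.real, h, ENNReal.toReal_ofReal (Real.exp_pos _).le]
    have h4 : volume.real (B 0) ≤ 4 := ENNReal.toReal_le_of_le_ofReal (by norm_num) hvol
    have h5 : (0 : ℝ) ≤ volume.real (B 0) := measureReal_nonneg
    exact Real.exp_le_exp.2 (by nlinarith)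
  have h1 := hpt (hBm 1) (by simp [hB])
  have h2 := hpt (hBm 2) (by simp [hB])
  have hpos : 0 ≤ 1 - Real.exp (-a) := by
    rw [sub_nonneg, Real.exp_le_one_iff]; linarith
  have hprod : Real.exp (-(4 * b)) * (1 - Real.exp (-a)) ^ 2 ≤
      P.real (⋂ i ∈ (Finset.univ : Finset (Fin 3)),
        (fun ω => Set.encard (X ω ∩ B i)) ⁻¹'
          (![{0}, {0}ᶜ, {0}ᶜ] : Fin 3 → Set ℕ∞) i) := by
    rw [Measure.real, hind, ENNReal.toReal_mul, ENNReal.toReal_mul, mul_assoc, sq]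
    exact mul_le_mul h0 (mul_le_mul h1 h2 hpos measureReal_nonneg)
      (mul_nonneg hpos hpos) measureReal_nonneg
  refine hprod.trans (ENNReal.toReal_mono (measure_ne_top _ _) (measure_mono_ae ?_))
  filter_upwards [hX.ae_isGood hr] with ω hω h
  replace h : ∀ i : Fin 3, Set.encard (X ω ∩ B i) ∈
      (![{0}, {0}ᶜ, {0}ᶜ] : Fin 3 → Set ℕ∞) i := fun i => Set.mem_iInter₂.1 h i (Finset.mem_univ i)
  exact hω.mid_sub_mid_le (Set.encard_eq_zero.1 (h 0)) (Set.encard_ne_zero.1 (h 1))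
    (Set.encard_ne_zero.1 (h 2))

end IsPoissonPointProcess

/-! ### The potential -/

/-- A bounded function of the width of an interval that decreases on average; the last term accounts
for the narrow intervals, whose width is likely to drop to zero. -/
noncomputable def potential (θ z : ℝ) : ℝ :=
  1 - Real.exp (-(θ * z)) + if 0 < z then θ ^ 2 else 0

lemma measurable_potential (θ : ℝ) : Measurable (potential θ) := by
  unfold potential
  refine Measurable.add (by fun_prop) ?_
  exact Measurable.ite measurableSet_Ioi measurable_const measurable_const

lemma potential_nonneg {θ z : ℝ} (hθ : 0 ≤ θ) (hz : 0 ≤ z) : 0 ≤ potential θ z := by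
  have h1 : Real.exp (-(θ * z)) ≤ 1 := Real.exp_le_one_iff.2 (by nlinarith)
  unfold potential
  split_ifs <;> nlinarith [sq_nonneg θ]

lemma potential_le (θ z : ℝ) : potential θ z ≤ 1 + θ ^ 2 := by
  have h1 := Real.exp_pos (-(θ * z))
  unfold potential
  split_ifs <;> nlinarith [sq_nonneg θ]

lemma potential_le_add {θ z : ℝ} : potential θ z ≤ θ * z + θ ^ 2 := by
  have h1 := Real.add_one_le_exp (-(θ * z))
  unfold potential
  split_ifs <;> nlinarith [sq_nonneg θ]

/-- The average decrease of the potential in one step, per unit of `θ ^ 2`. -/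
noncomputable def decreaseRate (a b : ℝ) : ℝ :=
  Real.exp (-(4 * b)) * (1 - Real.exp (-a)) ^ 2 / 2

lemma decreaseRate_pos {a b : ℝ} (ha : 0 < a) : 0 < decreaseRate a b := by
  have : Real.exp (-a) < 1 := by rw [Real.exp_lt_one_iff]; linarith
  have h2 : 0 < 1 - Real.exp (-a) := by linarith
  unfold decreaseRate
  positivity

lemma decreaseRate_le {a b : ℝ} (ha : 0 < a) : decreaseRate a b ≤ Real.exp (-(4 * b)) := by
  have h1 : Real.exp (-a) < 1 := by rw [Real.exp_lt_one_iff]; linarith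
  have h2 := Real.exp_pos (-a)
  have h3 : (1 - Real.exp (-a)) ^ 2 ≤ 1 := by nlinarith
  have h4 := Real.exp_pos (-(4 * b))
  unfold decreaseRate
  nlinarith

/-- Jensen's inequality for the exponential, with a gain from the event that the random variable is
below its mean by one. -/
lemma le_integral_exp_neg {Ω : Type*} [MeasurableSpace Ω] {P : Measure Ω} [IsProbabilityMeasure P]
    {Z : Ω → ℝ} (hZm : Measurable Z) (hZint : Integrable Z P) {m : ℝ} (hm : ∫ ω, Z ω ∂P = m)
    {θ : ℝ} (hθ : 0 ≤ θ) (hexp : Integrable (fun ω => Real.exp (-(θ * Z ω))) P) :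
    Real.exp (-(θ * m)) * (1 + θ ^ 2 / 2 * P.real {ω | Z ω ≤ m - 1}) ≤
      ∫ ω, Real.exp (-(θ * Z ω)) ∂P := by
  have hGm : MeasurableSet {ω | Z ω ≤ m - 1} := hZm measurableSet_Iic
  set G : Set Ω := {ω | Z ω ≤ m - 1} with hG
  have hf1 : Integrable (fun ω => 1 - θ * (Z ω - m)) P :=
    (integrable_const 1).sub ((hZint.sub (integrable_const _)).const_mul θ)
  have hf2 : Integrable (fun ω => G.indicator (fun _ => θ ^ 2 / 2) ω) P :=
    (integrable_const _).indicator hGm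
  have hcalc : ∫ ω, Real.exp (-(θ * m)) *
      ((1 - θ * (Z ω - m)) + G.indicator (fun _ => θ ^ 2 / 2) ω) ∂P =
      Real.exp (-(θ * m)) * (1 + θ ^ 2 / 2 * P.real G) := by
    have h0 : Integrable (fun ω => θ * (Z ω - m)) P :=
      (hZint.sub (integrable_const _)).const_mul θ
    have h1 : ∫ ω, (1 - θ * (Z ω - m)) ∂P = 1 := by
      rw [integral_sub (integrable_const 1) h0, integral_const_mul, integral_sub hZint (integrable_const _), hm]
      simp
    rw [integral_const_mul, integral_add hf1 hf2, h1, integral_indicator hGm, setIntegral_const,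
      smul_eq_mul, mul_comm (P.real G)]
  rw [← hcalc]
  refine integral_mono ((hf1.add hf2).const_mul _) hexp fun ω => ?_
  have hsplit : Real.exp (-(θ * Z ω)) =
      Real.exp (-(θ * m)) * Real.exp (-(θ * (Z ω - m))) := by
    rw [← Real.exp_add]; ring_nf
  simp only [hsplit]
  refine mul_le_mul_of_nonneg_left ?_ (Real.exp_pos _).le
  -- With `y = -(θ * (Z - m))`, the bound `1 + y ≤ exp y` holds everywhere; on `G` one has `y ≥ θ`,
  -- and the quadratic term adds `θ ^ 2 / 2`.
  by_cases hω : ω ∈ G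
  · rw [Set.indicator_of_mem hω]
    have hω' : 1 ≤ -(Z ω - m) := by linarith [show Z ω ≤ m - 1 from hω]
    have h1 : θ ≤ -(θ * (Z ω - m)) := by nlinarith
    have h2 := Real.quadratic_le_exp_of_nonneg (hθ.trans h1)
    have h3 : θ ^ 2 ≤ (-(θ * (Z ω - m))) ^ 2 := pow_le_pow_left₀ hθ h1 2
    linarith
  · rw [Set.indicator_of_notMem hω]
    linarith [Real.add_one_le_exp (-(θ * (Z ω - m)))]

/-! ### Decrease of the potential across one column -/

namespace IsPoissonPointProcess

variable {Ω : Type*} [MeasurableSpace Ω] {P : Measure Ω} [IsProbabilityMeasure P] {X : Ω → Set ℝ}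
  {r : ℝ}

lemma integrable_exp_mid_sub_mid (hr : 0 < r)
    (hX : IsPoissonPointProcess P X (ENNReal.ofReal r • volume)) {θ d e : ℝ} (hθ : 0 ≤ θ)
    (hde : d ≤ e) :
    Integrable (fun ω => Real.exp (-(θ * (mid e (X ω) - mid d (X ω))))) P := by
  refine Integrable.of_bound (C := 1) ?_ (ae_of_all _ fun ω => ?_)
  · exact Real.continuous_exp.comp_aestronglyMeasurable
      (((hX.integrable_mid hr e).sub (hX.integrable_mid hr d)).const_mul θ).neg.1
  · rw [Real.norm_of_nonneg (Real.exp_pos _).le, Real.exp_le_one_iff]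
    have := mid_mono (X ω) hde
    simp only at this
    nlinarith

lemma le_integral_exp_mid_sub_mid (hr : 0 < r)
    (hX : IsPoissonPointProcess P X (ENNReal.ofReal r • volume)) {θ d e : ℝ} (hθ : 0 ≤ θ)
    (hde : d ≤ e) :
    Real.exp (-(θ * (e - d))) *
        (1 + θ ^ 2 / 2 * P.real {ω | mid e (X ω) - mid d (X ω) ≤ e - d - 1}) ≤
      ∫ ω, Real.exp (-(θ * (mid e (X ω) - mid d (X ω)))) ∂P := by
  refine le_integral_exp_neg (hX.measurable_mid_sub_mid d e)
    ((hX.integrable_mid hr e).sub (hX.integrable_mid hr d)) ?_ hθ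
    (hX.integrable_exp_mid_sub_mid hr hθ hde)
  rw [integral_sub (hX.integrable_mid hr e) (hX.integrable_mid hr d), hX.integral_mid hr,
    hX.integral_mid hr]

lemma integrable_potential
    {ν : Measure ℝ} (hX : IsPoissonPointProcess P X ν) {θ d e : ℝ} (hθ : 0 ≤ θ)
    (hde : d ≤ e) :
    Integrable (fun ω => potential θ (mid e (X ω) - mid d (X ω))) P := by
  refine Integrable.of_bound (C := 1 + θ ^ 2) ?_ (ae_of_all _ fun ω => ?_)
  · exact ((measurable_potential θ).comp (hX.measurable_mid_sub_mid d e)).aestronglyMeasurable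
  · rw [Real.norm_of_nonneg (potential_nonneg hθ (sub_nonneg.2 (mid_mono (X ω) hde)))]
    exact potential_le _ _

/-- Without a point in `(d, e]` the two midpoints coincide, so the jump `θ ^ 2` is paid at most on
the event that there is one. -/
lemma integral_potential_le (hr : 0 < r)
    (hX : IsPoissonPointProcess P X (ENNReal.ofReal r • volume)) {θ d e : ℝ} (hθ : 0 ≤ θ)
    (hde : d ≤ e) :
    ∫ ω, potential θ (mid e (X ω) - mid d (X ω)) ∂P ≤
      1 - ∫ ω, Real.exp (-(θ * (mid e (X ω) - mid d (X ω)))) ∂P +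
        θ ^ 2 * P.real {ω | next d (X ω) ≤ e} := by
  have hHm : MeasurableSet {ω | next d (X ω) ≤ e} := hX.measurable_next_const d measurableSet_Iic
  have hi := hX.integrable_exp_mid_sub_mid hr hθ hde
  have hf1 : Integrable (fun ω => 1 - Real.exp (-(θ * (mid e (X ω) - mid d (X ω))))) P :=
    (integrable_const 1).sub hi
  have hf2 : Integrable ({ω | next d (X ω) ≤ e}.indicator (fun _ => θ ^ 2)) P :=
    (integrable_const _).indicator hHm
  calc _ ≤ ∫ ω, ((1 - Real.exp (-(θ * (mid e (X ω) - mid d (X ω))))) +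
        {ω | next d (X ω) ≤ e}.indicator (fun _ => θ ^ 2) ω) ∂P := by
        refine integral_mono_ae (hX.integrable_potential hθ hde) (hf1.add hf2) ?_
        filter_upwards [hX.ae_isGood hr] with ω hω
        simp only [potential]
        gcongr
        by_cases h : next d (X ω) ≤ e
        · rw [Set.indicator_of_mem (show ω ∈ {ω | next d (X ω) ≤ e} from h)]
          split_ifs <;> nlinarith [sq_nonneg θ]
        · rw [hω.mid_eq_of_lt_next hde (not_le.1 h), 
            Set.indicator_of_notMem (show ω ∉ {ω | next d (X ω) ≤ e} from h)]
          simp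
    _ = _ := by
        rw [integral_add hf1 hf2, integral_sub (integrable_const 1) hi, integral_indicator hHm,
          setIntegral_const, smul_eq_mul, mul_comm (P.real _)]
        simp

lemma measure_next_le_le (hr : 0 < r)
    (hX : IsPoissonPointProcess P X (ENNReal.ofReal r • volume)) {b d e : ℝ} (hrb : r ≤ b)
    (hde : d ≤ e) (hed : e ≤ d + 4) :
    P.real {ω | next d (X ω) ≤ e} ≤ 1 - Real.exp (-(4 * b)) := by
  have hHm : MeasurableSet {ω | next d (X ω) ≤ e} := hX.measurable_next_const d measurableSet_Iic
  have h := hX.measure_inter_eq_empty hr (measurableSet_Ioc (a := d) (b := e)) (by simp)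
  have h2 : P {ω | next d (X ω) ≤ e}ᶜ = P {ω | X ω ∩ Set.Ioc d e = ∅} := by
    refine measure_congr ?_
    filter_upwards [hX.ae_isGood hr] with ω hω
    refine propext ?_
    change ¬ (next d (X ω) ≤ e) ↔ X ω ∩ Set.Ioc d e = ∅
    rw [hω.next_le_iff, Set.not_nonempty_iff_eq_empty]
  have h3 := probReal_compl_eq_one_sub (μ := P) hHm
  rw [Measure.real, h2, h, ENNReal.toReal_ofReal (Real.exp_pos _).le] at h3
  have h4 : volume.real (Set.Ioc d e) = e - d := by
    simp [Measure.real, hde]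
  rw [h4] at h3
  have h5 : Real.exp (-(4 * b)) ≤ Real.exp (-(r * (e - d))) := Real.exp_le_exp.2 (by nlinarith)
  linarith

/-- The potential of the width decreases on average, by an amount controlled by the probability that
the interval contains a point. -/
lemma integral_potential_mid_sub_mid {a b : ℝ} (ha : 0 < a) (har : a ≤ r) (hrb : r ≤ b)
    (hX : IsPoissonPointProcess P X (ENNReal.ofReal r • volume)) {θ d e : ℝ} (hθ : 0 ≤ θ)
    (hde : d ≤ e) :
    ∫ ω, potential θ (mid e (X ω) - mid d (X ω)) ∂P ≤ potential θ (e - d) ∧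
    ∫ ω, potential θ (mid e (X ω) - mid d (X ω)) ∂P + decreaseRate a b * θ ^ 2 *
      (P.real {ω | next d (X ω) ≤ e} - potential θ (e - d)) ≤ potential θ (e - d) := by
  have hr : 0 < r := ha.trans_le har
  have hc := decreaseRate_pos (b := b) ha
  have hcle := decreaseRate_le (b := b) ha
  have hθ2 := sq_nonneg θ
  have hI := hX.integral_potential_le hr hθ hde
  have hJ := hX.le_integral_exp_mid_sub_mid hr hθ hde
  have hH1 : P.real {ω | next d (X ω) ≤ e} ≤ 1 := measureReal_le_one
  have hpot := potential_nonneg hθ (sub_nonneg.2 hde)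
  have hE := Real.exp_pos (-(θ * (e - d)))
  have hG : 0 ≤ P.real {ω | mid e (X ω) - mid d (X ω) ≤ e - d - 1} := measureReal_nonneg
  set H := P.real {ω | next d (X ω) ≤ e}
  set G := P.real {ω | mid e (X ω) - mid d (X ω) ≤ e - d - 1} with hGdef
  set E := Real.exp (-(θ * (e - d))) with hEdef
  set c := decreaseRate a b with hcdef
  have hEG : 0 ≤ E * (θ ^ 2 / 2 * G) := by positivity
  rcases hde.eq_or_lt with rfl | hlt
  · have h0 : potential θ (d - d) = 0 := by simp [potential]
    have hH0 : H = 0 := by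
      have : P {ω | next d (X ω) ≤ d} = 0 := by
        have := hX.ae_isGood hr
        refine measure_mono_null (fun ω hω => ?_) this
        exact fun h : IsGood (X ω) => absurd (h.lt_next d) (not_lt.2 hω)
      simp [H, Measure.real, this]
    simp only [sub_self] at h0
    simp [h0, hH0]
  · have hpe : potential θ (e - d) = 1 - E + θ ^ 2 := by simp [potential, hlt, hEdef]
    have hmain : ∫ ω, potential θ (mid e (X ω) - mid d (X ω)) ∂P ≤
        1 - E * (1 + θ ^ 2 / 2 * G) + θ ^ 2 * H := by linarith
    refine ⟨?_, ?_⟩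
    · nlinarith
    · rcases le_or_gt e (d + 4) with h4 | h4
      -- Narrow interval: it is empty with probability at least `exp (-(4 * b)) ≥ c`, so the jump
      -- term loses `c * θ ^ 2` on average.
      · have hH := hX.measure_next_le_le hr hrb hde h4
        have h5 : θ ^ 2 * H ≤ θ ^ 2 * (1 - c) := by gcongr; linarith
        have h6 : c * θ ^ 2 * (H - potential θ (e - d)) ≤ c * θ ^ 2 * 1 := by
          gcongr; linarith
        nlinarith
      -- Wide interval: the Jensen gain is only `E * (θ ^ 2 / 2) * G`, small when the width is
      -- large. Subtracting the potential compensates for this, since `H - potential θ (e - d) ≤ E`.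
      · have hG' := hX.le_measure_mid_sub_mid ha har hrb h4
        have h5 : c ≤ G / 2 := by
          rw [hcdef, decreaseRate, hGdef]
          gcongr
        have h6 : c * θ ^ 2 * (H - potential θ (e - d)) ≤ c * θ ^ 2 * E := by
          gcongr; rw [hpe]; linarith
        have h7 : c * θ ^ 2 * E ≤ G / 2 * θ ^ 2 * E := by gcongr
        nlinarith

end IsPoissonPointProcess

/-! ### The boundaries as a process in the columns -/

/-- To bound the mean of a function of two independent random variables, it suffices to bound its
means with the first argument frozen. -/
lemma integral_le_of_indepFun {Ω α β : Type*} [MeasurableSpace Ω] [MeasurableSpace α]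
    [MeasurableSpace β] {P : Measure Ω} [IsProbabilityMeasure P] {f : Ω → α} {g : Ω → β}
    (hf : Measurable f) (hg : Measurable g) (hfg : IndepFun f g P) {F : α × β → ℝ}
    (hF : Measurable F) {C : ℝ} (hC : ∀ p, |F p| ≤ C) {G : Ω → ℝ} (hG : Integrable G P)
    (h : ∀ ω, ∫ ω', F (f ω, g ω') ∂P ≤ G ω) :
    ∫ ω, F (f ω, g ω) ∂P ≤ ∫ ω, G ω ∂P := by
  have : IsProbabilityMeasure (P.map f) := Measure.isProbabilityMeasure_map hf.aemeasurable
  have : IsProbabilityMeasure (P.map g) := Measure.isProbabilityMeasure_map hg.aemeasurable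
  have hint : Integrable F ((P.map f).prod (P.map g)) :=
    Integrable.of_bound hF.aestronglyMeasurable C (ae_of_all _ fun p => hC p)
  have hint' : Integrable (fun x => ∫ y, F (x, y) ∂(P.map g)) (P.map f) := hint.integral_prod_left
  have h1 : ∀ x, ∫ y, F (x, y) ∂(P.map g) = ∫ ω', F (x, g ω') ∂P := fun x =>
    integral_map hg.aemeasurable (hF.comp measurable_prodMk_left).aestronglyMeasurable
  calc ∫ ω, F (f ω, g ω) ∂P = ∫ p, F p ∂(P.map fun ω => (f ω, g ω)) :=
        (integral_map (hf.prodMk hg).aemeasurable hF.aestronglyMeasurable).symm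
    _ = ∫ ω, ∫ y, F (f ω, y) ∂(P.map g) ∂P := by
        rw [(indepFun_iff_map_prod_eq_prod_map_map hf.aemeasurable hg.aemeasurable).1 hfg,
          integral_prod _ hint, integral_map hf.aemeasurable hint'.1]
    _ ≤ _ := by
        refine integral_mono ?_ hG fun ω => ?_
        · exact hint'.comp_measurable hf
        · simpa only [h1] using h ω

section Boundaries

variable {Ω : Type*}

lemma measurable_mid_comp {m : MeasurableSpace Ω} {f : Ω → ℝ} {S : Ω → PointSet}
    (hf : Measurable f) (hS : Measurable S) : Measurable fun ω => mid (f ω) (S ω) :=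
  ((measurable_prev.comp (hf.prodMk hS)).add (measurable_next.comp (hf.prodMk hS))).div_const 2

/-- The lower and the upper boundary of the region whose traffic flows through `(d, e]` in the column
`Y 0`, when they have reached the column `Y k`. -/
noncomputable def boundaries (Y : ℕ → Ω → Set ℝ) (d e : ℝ) : ℕ → Ω → ℝ × ℝ
  | 0, _ => (d, e)
  | k + 1, ω => (mid (boundaries Y d e k ω).1 (Y k ω), mid (boundaries Y d e k ω).2 (Y k ω))

lemma boundaries_le (Y : ℕ → Ω → Set ℝ) {d e : ℝ} (hde : d ≤ e) (k : ℕ) (ω : Ω) :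
    (boundaries Y d e k ω).1 ≤ (boundaries Y d e k ω).2 := by
  induction k with
  | zero => exact hde
  | succ k ih => exact mid_mono (Y k ω) ih

/-- At stage `k` only the columns `Y i` with `i < k` have been used; this gives independence from `Y
k`. -/
lemma measurable_boundaries_iSup (Y : ℕ → Ω → Set ℝ) (d e : ℝ) (k : ℕ) :
    Measurable[⨆ i ∈ Set.Iio k, generatedSigmaAlgebra (Y i)] (boundaries Y d e k) := by
  induction k with
  | zero => exact measurable_const
  | succ k ih =>
    have h1 : (⨆ i ∈ Set.Iio k, generatedSigmaAlgebra (Y i)) ≤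
        ⨆ i ∈ Set.Iio (k + 1), generatedSigmaAlgebra (Y i) :=
      biSup_mono fun i (hi : i < k) => hi.trans k.lt_succ_self
    have h2 : @Measurable Ω PointSet (⨆ i ∈ Set.Iio (k + 1), generatedSigmaAlgebra (Y i)) _
        (Y k) :=
      measurable_iff_comap_le.2 ((comap_pointSet (Y k)).le.trans
        (le_biSup (fun i => generatedSigmaAlgebra (Y i)) (Set.mem_Iio.2 k.lt_succ_self)))
    have h3 := ih.mono h1 le_rfl
    exact (measurable_mid_comp (measurable_fst.comp h3) h2).prodMk
      (measurable_mid_comp (measurable_snd.comp h3) h2)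

variable [MeasurableSpace Ω] {P : Measure Ω}

lemma indepFun_boundaries {Y : ℕ → Ω → Set ℝ} {ν : ℕ → Measure ℝ}
    (hY : ∀ k, IsPoissonPointProcess P (Y k) (ν k))
    (hind : iIndep (fun k => generatedSigmaAlgebra (Y k)) P) (d e : ℝ) (k : ℕ) :
    Measurable (boundaries Y d e k) ∧
      IndepFun (γ := PointSet) (boundaries Y d e k) (Y k) P := by
  have hle : ∀ i, generatedSigmaAlgebra (Y i) ≤ (inferInstance : MeasurableSpace Ω) := fun i =>
    iSup₂_le fun B hB => ((hY i).measurable_count B hB).comap_le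
  have hm := measurable_boundaries_iSup Y d e k
  refine ⟨hm.mono (iSup₂_le fun i _ => hle i) le_rfl, ?_⟩
  have h := indep_iSup_of_disjoint hle hind (S := Set.Iio k) (T := {k})
    (Set.disjoint_singleton_right.2 (lt_irrefl k))
  rw [iSup_singleton] at h
  refine (IndepFun_iff_Indep _ _ _).2 ?_
  exact indep_of_indep_of_le_right (indep_of_indep_of_le_left h hm.comap_le)
    (comap_pointSet (Y k)).le

lemma measurableSet_next_le {Y : ℕ → Ω → Set ℝ} {d e : ℝ} {k : ℕ} {ν : Measure ℝ}
    (hY : IsPoissonPointProcess P (Y k) ν) (hm : Measurable (boundaries Y d e k)) :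
    MeasurableSet {ω | next (boundaries Y d e k ω).1 (Y k ω) ≤ (boundaries Y d e k ω).2} :=
  measurableSet_le (measurable_next.comp ((measurable_fst.comp hm).prodMk hY.measurable))
    (measurable_snd.comp hm)

variable [IsProbabilityMeasure P]

lemma integrable_potential_boundaries {Y : ℕ → Ω → Set ℝ} {d e θ : ℝ} (hθ : 0 ≤ θ) (hde : d ≤ e)
    {k : ℕ} (hm : Measurable (boundaries Y d e k)) :
    Integrable (fun ω => potential θ ((boundaries Y d e k ω).2 - (boundaries Y d e k ω).1)) P := by
  refine Integrable.of_bound (C := 1 + θ ^ 2) ?_ (ae_of_all _ fun ω => ?_)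
  · exact ((measurable_potential θ).comp
      ((measurable_snd.comp hm).sub (measurable_fst.comp hm))).aestronglyMeasurable
  · rw [Real.norm_of_nonneg (potential_nonneg hθ (sub_nonneg.2 (boundaries_le Y hde k ω)))]
    exact potential_le _ _

/-- The one-column estimate, applied with the boundaries frozen and then averaged over them. -/
lemma integral_potential_boundaries_succ {Y : ℕ → Ω → Set ℝ} {a b d e θ : ℝ} {r : ℕ → ℝ}
    (ha : 0 < a) (har : ∀ k, a ≤ r k) (hrb : ∀ k, r k ≤ b)
    (hY : ∀ k, IsPoissonPointProcess P (Y k) (ENNReal.ofReal (r k) • volume))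
    (hind : iIndep (fun k => generatedSigmaAlgebra (Y k)) P) (hθ : 0 ≤ θ) (hde : d ≤ e) (k : ℕ) :
    let A := fun k => ∫ ω, potential θ ((boundaries Y d e k ω).2 - (boundaries Y d e k ω).1) ∂P
    A (k + 1) ≤ A k ∧ A (k + 1) + decreaseRate a b * θ ^ 2 *
      (P.real {ω | next (boundaries Y d e k ω).1 (Y k ω) ≤ (boundaries Y d e k ω).2} - A k) ≤
      A k := by
  intro A
  obtain ⟨hm, hindep⟩ := indepFun_boundaries hY hind d e k
  have hm' := (indepFun_boundaries hY hind d e (k + 1)).1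
  have hle := fun ω => boundaries_le Y hde k ω
  have hint := integrable_potential_boundaries (P := P) hθ hde hm
  have hint' := integrable_potential_boundaries (P := P) hθ hde hm'
  have hHm := measurableSet_next_le (hY k) hm
  have hH (x : ℝ × ℝ) : MeasurableSet {ω' | next x.1 (Y k ω') ≤ x.2} :=
    (hY k).measurable_next_const x.1 measurableSet_Iic
  have habs : ∀ z, |potential θ (|z|)| ≤ 1 + θ ^ 2 := fun z => by
    rw [abs_of_nonneg (potential_nonneg hθ (abs_nonneg z))]
    exact potential_le _ _
  have hone := fun ω => (hY k).integral_potential_mid_sub_mid ha (har k) (hrb k) hθ (hle ω)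
  have hpm : ∀ ω S, |mid (boundaries Y d e k ω).2 S - mid (boundaries Y d e k ω).1 S| =
      mid (boundaries Y d e k ω).2 S - mid (boundaries Y d e k ω).1 S := fun ω S =>
    abs_of_nonneg (sub_nonneg.2 (mid_mono S (hle ω)))
  have hpd : ∀ ω, |(boundaries Y d e k ω).2 - (boundaries Y d e k ω).1| =
      (boundaries Y d e k ω).2 - (boundaries Y d e k ω).1 := fun ω =>
    abs_of_nonneg (sub_nonneg.2 (hle ω))
  -- The absolute value keeps `F` bounded on pairs in the wrong order; the boundaries are never in
  -- that order.
  set F : (ℝ × ℝ) × PointSet → ℝ := fun q => potential θ |mid q.1.2 q.2 - mid q.1.1 q.2| with hF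
  have hFm : Measurable F := (measurable_potential θ).comp
    ((measurable_mid_comp (measurable_snd.comp measurable_fst) measurable_snd).sub
      (measurable_mid_comp (measurable_fst.comp measurable_fst) measurable_snd)).abs
  set T : Set ((ℝ × ℝ) × PointSet) := {q | next q.1.1 q.2 ≤ q.1.2}
  have hTm : MeasurableSet T := measurableSet_le
    (measurable_next.comp ((measurable_fst.comp measurable_fst).prodMk measurable_snd))
    (measurable_snd.comp measurable_fst)
  set K : ℝ := decreaseRate a b * θ ^ 2 with hK
  have hK0 : 0 ≤ K := mul_nonneg (decreaseRate_pos ha).le (sq_nonneg θ)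
  set F' : (ℝ × ℝ) × PointSet → ℝ := fun q =>
    F q + K * (T.indicator (fun _ => 1) q - potential θ |q.1.2 - q.1.1|) with hF'
  have hF'm : Measurable F' := hFm.add (((measurable_const.indicator hTm).sub
    ((measurable_potential θ).comp ((measurable_snd.comp measurable_fst).sub
      (measurable_fst.comp measurable_fst)).abs)).const_mul K)
  have hF'le : ∀ q, |F' q| ≤ (1 + θ ^ 2) + K * (1 + (1 + θ ^ 2)) := by
    intro q
    refine (abs_add_le _ _).trans (add_le_add (habs _) ?_)
    rw [abs_mul, abs_of_nonneg hK0]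
    refine mul_le_mul_of_nonneg_left ((abs_sub _ _).trans (add_le_add ?_ (habs _))) hK0
    by_cases hq : q ∈ T
    · simp [hq]
    · simp [hq]
  constructor
  · have h := integral_le_of_indepFun (F := F) hm (hY k).measurable hindep hFm
      (fun q => habs _) hint fun ω => by
        simp only [hF, hpm]
        exact (hone ω).1
    simp only [hF, hpm] at h
    exact h
  · have h := integral_le_of_indepFun (F := F') hm (hY k).measurable hindep hF'm
      hF'le hint fun ω => by
        have hi1 := (hY k).integrable_potential hθ (hle ω)
        have hi2 : Integrable ({ω' | next (boundaries Y d e k ω).1 (Y k ω') ≤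
            (boundaries Y d e k ω).2}.indicator fun _ => (1 : ℝ)) P :=
          (integrable_const _).indicator (hH _)
        have heq : ∀ ω', F' (boundaries Y d e k ω, Y k ω') =
            potential θ (mid (boundaries Y d e k ω).2 (Y k ω') -
              mid (boundaries Y d e k ω).1 (Y k ω')) +
            K * ({ω' | next (boundaries Y d e k ω).1 (Y k ω') ≤
              (boundaries Y d e k ω).2}.indicator (fun _ => (1 : ℝ)) ω' -
              potential θ ((boundaries Y d e k ω).2 - (boundaries Y d e k ω).1)) := by
          intro ω'
          simp only [hF', hF, hpm, hpd]
          rfl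
        simp only [heq]
        have hi3 : Integrable (fun ω' => K * ({ω' | next (boundaries Y d e k ω).1 (Y k ω') ≤
              (boundaries Y d e k ω).2}.indicator (fun _ => (1 : ℝ)) ω' -
              potential θ ((boundaries Y d e k ω).2 - (boundaries Y d e k ω).1))) P :=
          (hi2.sub (integrable_const _)).const_mul K
        rw [integral_add hi1 hi3, integral_const_mul, integral_sub hi2 (integrable_const _),
          integral_indicator (hH _), setIntegral_const]
        simpa using (hone ω).2
    have hi2 : Integrable ({ω | next (boundaries Y d e k ω).1 (Y k ω) ≤
        (boundaries Y d e k ω).2}.indicator fun _ => (1 : ℝ)) P :=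
      (integrable_const _).indicator hHm
    have heq : ∀ ω, F' (boundaries Y d e k ω, Y k ω) =
        potential θ ((boundaries Y d e (k + 1) ω).2 - (boundaries Y d e (k + 1) ω).1) +
        K * ({ω | next (boundaries Y d e k ω).1 (Y k ω) ≤
          (boundaries Y d e k ω).2}.indicator (fun _ => (1 : ℝ)) ω -
          potential θ ((boundaries Y d e k ω).2 - (boundaries Y d e k ω).1)) := by
      intro ω
      simp only [hF', hF, hpm, hpd]
      rfl
    simp only [heq] at h
    have hi3 : Integrable (fun ω => K * ({ω | next (boundaries Y d e k ω).1 (Y k ω) ≤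
          (boundaries Y d e k ω).2}.indicator (fun _ => (1 : ℝ)) ω -
          potential θ ((boundaries Y d e k ω).2 - (boundaries Y d e k ω).1))) P :=
      (hi2.sub hint).const_mul K
    rw [integral_add hint' hi3, integral_const_mul, integral_sub hi2 hint,
      integral_indicator hHm, setIntegral_const] at h
    simpa using h

/-- The probability that the region between the boundaries contains points of the first `n`
columns. -/
lemma measure_forall_next_le {Y : ℕ → Ω → Set ℝ} {a b d e : ℝ} {r : ℕ → ℝ}
    (ha : 0 < a) (har : ∀ k, a ≤ r k) (hrb : ∀ k, r k ≤ b)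
    (hY : ∀ k, IsPoissonPointProcess P (Y k) (ENNReal.ofReal (r k) • volume))
    (hind : iIndep (fun k => generatedSigmaAlgebra (Y k)) P) (hde : d ≤ e) {n : ℕ} (hn : 0 < n) :
    P.real {ω | ∀ k < n, next (boundaries Y d e k ω).1 (Y k ω) ≤ (boundaries Y d e k ω).2} ≤
      (1 + 1 / decreaseRate a b) * ((e - d + 1) / √n) := by
  -- With this `θ`, the `n` losses of order `θ ^ 2` add up to order one, while the initial potential
  -- has order `(e - d + 1) / √n`.
  set θ : ℝ := 1 / √n with hθdef
  have hn' : (1 : ℝ) ≤ n := by exact_mod_cast hn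
  have hsq : 1 ≤ √(n : ℝ) := Real.one_le_sqrt.2 hn'
  have hθ : 0 < θ := by positivity
  have hθ1 : θ ≤ 1 := by rw [hθdef, div_le_one (by linarith)]; exact hsq
  have hnθ : n * θ ^ 2 = 1 := by
    rw [hθdef, div_pow, Real.sq_sqrt (by linarith)]
    field_simp
  set c := decreaseRate a b with hc
  have hc0 : 0 < c := decreaseRate_pos ha
  set p := P.real {ω | ∀ k < n, next (boundaries Y d e k ω).1 (Y k ω) ≤ (boundaries Y d e k ω).2}
  set A := fun k => ∫ ω, potential θ ((boundaries Y d e k ω).2 - (boundaries Y d e k ω).1) ∂P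
    with hA
  have hstep := fun k => integral_potential_boundaries_succ ha har hrb hY hind hθ.le hde k
  simp only at hstep
  have hA0 : A 0 ≤ θ * (e - d) + θ ^ 2 := by
    simpa [hA, boundaries] using potential_le_add (θ := θ) (z := e - d)
  have hAnonneg : ∀ k, 0 ≤ A k := fun k => integral_nonneg fun ω =>
    potential_nonneg hθ.le (sub_nonneg.2 (boundaries_le Y hde k ω))
  have hAle : ∀ k, A k ≤ A 0 := by
    intro k
    induction k with
    | zero => rfl
    | succ k ih => exact (hstep k).1.trans ih
  -- Survival through all `n` columns implies a hit in each, so `p` bounds every one-step hitting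
  -- probability from below; moreover `A k ≤ A 0`.
  have hsum : ∀ k ≤ n, A k + k * (c * θ ^ 2 * p) ≤ A 0 + k * (c * θ ^ 2 * A 0) := by
    intro k
    induction k with
    | zero => simp
    | succ k ih =>
      intro hk
      have h1 := ih (by omega)
      have h2 := (hstep k).2
      have h3 : p ≤ P.real {ω | next (boundaries Y d e k ω).1 (Y k ω) ≤
          (boundaries Y d e k ω).2} :=
        measureReal_mono fun ω hω => hω k (by omega)
      have h4 : c * θ ^ 2 * (p - A 0) ≤ c * θ ^ 2 *
          (P.real {ω | next (boundaries Y d e k ω).1 (Y k ω) ≤ (boundaries Y d e k ω).2} - A k) := by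
        have := hAle k
        gcongr
      push_cast
      simp only [hA] at h1 h2 h4 ⊢
      linarith
  have hfin := hsum n le_rfl
  have h5 : n * (c * θ ^ 2 * p) = c * p := by linear_combination c * p * hnθ
  have h6 : n * (c * θ ^ 2 * A 0) = c * A 0 := by linear_combination c * A 0 * hnθ
  have h7 : A 0 ≤ (e - d + 1) * θ := by nlinarith
  have h8 : c * p ≤ (1 + c) * ((e - d + 1) * θ) := by
    have := hAnonneg n
    nlinarith
  have h9 : p ≤ (1 + c) * ((e - d + 1) * θ) / c := by
    rw [le_div_iff₀ hc0]; linarith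
  refine h9.trans (le_of_eq ?_)
  rw [hθdef]
  field_simp
  ring

end Boundaries

/-! ### From paths to boundaries -/

/-- The nodes of a path into a slit lie between the boundaries started from the slit. -/
lemma forall_next_le_of_isPathInto {Ω : Type*} {X : ℤ → Ω → Set ℝ} {ω : Ω}
    {ℓ : ℝ} (hℓ : 0 < ℓ) {x : ℤ × ℝ} {p : List (ℤ × ℝ)}
    (hgood : ∀ k : ℕ, IsGood (X (x.1 + k) ω)) (hp : IsPathInto (nodes X ω) ℓ x p) {k : ℕ}
    (hk : k < p.length) :
    next (boundaries (fun k : ℕ => X (x.1 + k)) (x.2 - ℓ) (x.2 + ℓ) k ω).1 (X (x.1 + k) ω) ≤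
      (boundaries (fun k : ℕ => X (x.1 + k)) (x.2 - ℓ) (x.2 + ℓ) k ω).2 := by
  obtain ⟨hmem, hchain, v, hv, hvslit⟩ := hp
  rw [List.isChain_iff_getElem] at hchain
  -- Edges point left, so the path is read from its end: the `k`-th node from the last lies `k`
  -- columns to the right of the slit.
  have key : ∀ k : ℕ, ∀ hk : k < p.length, (p[p.length - 1 - k]'(by omega)).1 = x.1 + k ∧
      (p[p.length - 1 - k]'(by omega)).2 ∈
        Set.Ioc (boundaries (fun k : ℕ => X (x.1 + k)) (x.2 - ℓ) (x.2 + ℓ) k ω).1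
          (boundaries (fun k : ℕ => X (x.1 + k)) (x.2 - ℓ) (x.2 + ℓ) k ω).2 := by
    intro k
    induction k with
    | zero =>
      intro hk
      have hlast : p[p.length - 1 - 0]'(by omega) = v := by
        rw [List.getLast?_eq_getElem?, Option.mem_def, List.getElem?_eq_some_iff] at hv
        exact hv.2
      rw [hlast]
      obtain ⟨h1, h2, h3⟩ := hvslit
      refine ⟨by simpa using h1, ?_⟩
      -- Starting at distance `ℓ` rather than `ℓ / 2` fits the closed slit into the half-open
      -- interval.
      simp only [boundaries, Set.mem_Ioc]
      constructor <;> linarith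
    | succ k ih =>
      intro hk
      obtain ⟨h1, h2⟩ := ih (by omega)
      have hE := hchain (p.length - 1 - (k + 1)) (by omega)
      have hidx : p.length - 1 - (k + 1) + 1 = p.length - 1 - k := by omega
      simp only [hidx] at hE
      obtain ⟨-, hy, hcol, hnear⟩ := hE
      set u := p[p.length - 1 - (k + 1)]'(by omega)
      set w := p[p.length - 1 - k]'(by omega)
      have hu : u.1 = x.1 + (k + 1 : ℕ) := by
        push_cast; omega
      refine ⟨hu, ?_⟩
      have hw : w.2 ∈ X (x.1 + k) ω := by
        rw [← h1]; exact hy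
      refine (hgood k).mem_Ioc_mid hw h2 fun z hz hzw => ?_
      refine hnear (x.1 + k, z) hz ?_ ?_
      · simp only; omega
      · rintro h
        exact hzw (by rw [← h])
  obtain ⟨h1, h2⟩ := key k hk
  rw [(hgood k).next_le_iff]
  refine ⟨_, ?_, h2⟩
  have := hmem _ (List.getElem_mem (l := p) (n := p.length - 1 - k) (by omega))
  rw [← h1]
  exact this

/-- Path lengths are integers: if all were below `⌈t⌉₊`, their supremum would be at most `⌈t⌉₊ - 1 <
t`. This also covers an infinite supremum. -/
lemma exists_isPathInto_of_le_tau {N : Set (ℤ × ℝ)} {ℓ t : ℝ} {x : ℤ × ℝ} (ht : 0 < t)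
    (h : ENNReal.ofReal t ≤ (tau N ℓ x : ℝ≥0∞)) :
    ∃ p, IsPathInto N ℓ x p ∧ ⌈t⌉₊ ≤ p.length := by
  by_contra! hcon
  have hn : 0 < ⌈t⌉₊ := Nat.ceil_pos.2 ht
  have h1 : tau N ℓ x ≤ ((⌈t⌉₊ - 1 : ℕ) : ℕ∞) := by
    refine iSup₂_le fun p hp => ?_
    have := hcon p hp
    exact_mod_cast (by omega : p.length ≤ ⌈t⌉₊ - 1)
  have h2 : (tau N ℓ x : ℝ≥0∞) ≤ ((⌈t⌉₊ - 1 : ℕ) : ℝ≥0∞) := by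
    exact_mod_cast ENat.toENNReal_le.2 h1
  have h3 := h.trans h2
  rw [← ENNReal.ofReal_natCast, ENNReal.ofReal_le_ofReal_iff (by positivity)] at h3
  have := Nat.ceil_le.2 h3
  omega

lemma intensity_eq {lam : ℝ × ℝ → ℝ} (hlam : VerticallyHomogeneous lam) (ℓ : ℝ) (x₁ : ℤ) :
    intensity lam ℓ x₁ = ENNReal.ofReal (lam ((x₁ : ℝ) / ℓ ^ 2, 0)) • volume := by
  rw [intensity, ← withDensity_const]
  congr 1
  ext y
  rw [hlam _ _ 0]

end SemiLattice

/-! ### The tail bound -/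

theorem theorem2p4 (lam mu : ℝ × ℝ → ℝ) (hadm : SemiLattice.IsAdmissible lam mu)
    (hlam : SemiLattice.VerticallyHomogeneous lam) (hmu : SemiLattice.VerticallyHomogeneous mu) :
    ∃ C : ℝ, ∀ α : ℝ, 2 < α → ∀ ℓ : ℝ, 1 ≤ ℓ →
      ∀ (Ω : Type*) [MeasurableSpace Ω] (P : Measure Ω) [IsProbabilityMeasure P]
        (X : ℤ → Ω → Set ℝ), SemiLattice.IsPoissonSemiLattice P lam ℓ X →
        (⨆ x : ℤ × ℝ,
            P {ω | ENNReal.ofReal (ℓ ^ α) ≤ (SemiLattice.tau (SemiLattice.nodes X ω) ℓ x : ℝ≥0∞)})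
          < ENNReal.ofReal (C * ℓ ^ (1 - α / 2)) := by
  obtain ⟨a, b, ha, hab⟩ := hadm.bounds_lam
  have hc := SemiLattice.decreaseRate_pos (b := b) ha
  set c := SemiLattice.decreaseRate a b with hcdef
  -- The initial width is `2 * ℓ`, and `2 * ℓ + 1 ≤ 3 * ℓ` gives the factor `3`; the final `+ 1`
  -- makes the inequality strict after the supremum over `x`.
  refine ⟨3 * (1 + 1 / c) + 1, fun α _ ℓ hℓ Ω _ P _ X hX => ?_⟩
  have hℓ0 : 0 < ℓ := by linarith
  have hpow : 0 < ℓ ^ (1 - α / 2) := Real.rpow_pos_of_pos hℓ0 _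
  refine lt_of_le_of_lt (b := ENNReal.ofReal (3 * (1 + 1 / c) * ℓ ^ (1 - α / 2)))
    (iSup_le fun x => ?_) ?_
  · set n := ⌈ℓ ^ α⌉₊ with hn
    have hpos : 0 < ℓ ^ α := Real.rpow_pos_of_pos hℓ0 _
    set Y : ℕ → Ω → Set ℝ := fun k => X (x.1 + k) with hY
    set r : ℕ → ℝ := fun k => lam (((x.1 + k : ℤ) : ℝ) / ℓ ^ 2, 0) with hr
    have hPois : ∀ k, SemiLattice.IsPoissonPointProcess P (Y k) (ENNReal.ofReal (r k) • volume) :=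
      fun k => by
        rw [hr, ← SemiLattice.intensity_eq hlam]
        exact hX.poisson _
    have hind : iIndep (fun k => SemiLattice.generatedSigmaAlgebra (Y k)) P :=
      hX.indep.precomp (g := fun k : ℕ => x.1 + (k : ℤ)) fun i j hij => by simpa using hij
    have hgood : ∀ᵐ ω ∂P, ∀ k, SemiLattice.IsGood (Y k ω) :=
      ae_all_iff.2 fun k => (hPois k).ae_isGood (ha.trans_le (hab _).1)
    have hmain := SemiLattice.measure_forall_next_le ha (fun k => (hab _).1) (fun k => (hab _).2)
      hPois hind (d := x.2 - ℓ) (e := x.2 + ℓ) (by linarith) (Nat.ceil_pos.2 hpos)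
    have hle : P {ω | ENNReal.ofReal (ℓ ^ α) ≤
          (SemiLattice.tau (SemiLattice.nodes X ω) ℓ x : ℝ≥0∞)} ≤
        P {ω | ∀ k < n, SemiLattice.next (SemiLattice.boundaries Y (x.2 - ℓ) (x.2 + ℓ) k ω).1
          (Y k ω) ≤ (SemiLattice.boundaries Y (x.2 - ℓ) (x.2 + ℓ) k ω).2} := by
      refine measure_mono_ae ?_
      filter_upwards [hgood] with ω hω hτ k hk
      obtain ⟨p, hp, hlen⟩ := SemiLattice.exists_isPathInto_of_le_tau hpos hτ
      exact SemiLattice.forall_next_le_of_isPathInto hℓ0 hω hp (hk.trans_le hlen)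
    refine hle.trans ?_
    rw [← ENNReal.ofReal_toReal (measure_ne_top P _)]
    refine ENNReal.ofReal_le_ofReal (hmain.trans ?_)
    have hsqrt : ℓ ^ (α / 2) ≤ √(n : ℝ) := by
      refine Real.le_sqrt_of_sq_le ?_
      rw [← Real.rpow_natCast, ← Real.rpow_mul hℓ0.le]
      norm_num
      exact Nat.le_ceil _
    have hpos2 : 0 < ℓ ^ (α / 2) := Real.rpow_pos_of_pos hℓ0 _
    have h3 : (x.2 + ℓ - (x.2 - ℓ) + 1) / √(n : ℝ) ≤ 3 * ℓ ^ (1 - α / 2) := by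
      rw [Real.rpow_sub hℓ0, Real.rpow_one, ← mul_div_assoc]
      gcongr
      linarith
    calc _ ≤ (1 + 1 / c) * (3 * ℓ ^ (1 - α / 2)) := by gcongr
      _ = _ := by ring
  · exact (ENNReal.ofReal_lt_ofReal_iff (by positivity)).2 (by nlinarith)
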